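/- **Theorem.** Permutations are multiplied from left to right ($gu$ means first $g$, then $u$). An instance of Hidden Shift over permutation groups consists of a generating set of a group $G\le S_n$ and two injective functions $f_1,f_2$ on $G$, given by programs (which may call a black box) together with a unary bound on the time of one evaluation. A *shift* is an element $u\in G$ with $f_1(g)=f_2(gu)$ for all $g\in G$. Hidden Shift$_D$ is the problem to decide whether there is a shift; Hidden Shift$_S$ is the problem to find a shift, or to report that there is none. (a) Hidden Shift$_D$ and Hidden Shift$_S$ over permutation groups are polynomial-time equivalent: each of them is solved by an algorithm that uses an arbitrary oracle for the other one (correct on all instances of that problem) and runs in time polynomial in the size of the input. The algorithm and the polynomial do not depend on the black box or on the oracle. (b) Let $G\le S_n$, let $G^{(i)}$ be the pointwise stabilizer of $\{1,\dots,i\}$ in $G$, and for $0\le i<n$ let $C_{i+1}$ be a complete set of representatives of the right cosets of $G^{(i+1)}$ in $G^{(i)}$. Let $f_1,f_2$ be injective functions on $G$ with shift $u\in G$. Then $u=\sigma_n\sigma_{n-1}\cdots\sigma_1$ with factors $\sigma_{i+1}\in C_{i+1}$ such that for all $0\le i<n$ and all $\tau\in C_{i+1}$: there is a shift for the group $G^{(i+1)}$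 and the functions $x\mapsto f_1(x)$ and $x\mapsto f_2(x\,\tau\,\sigma_i\cdots\sigma_1)$ on it if and only if $\tau=\sigma_{i+1}$. -/

import Mathlib

open Equiv

/-! ### Programs with an oracle, and their running time -/

/-- The data that programs manipulate: finite binary trees. -/
inductive Data where
  | nil : Data
  | cons : Data → Data → Data

namespace Data

/-- The number of nodes of a tree, leaves included. -/
def size : Data → ℕ
  | nil => 1
  | cons x y => x.size + y.size + 1

/-- The left subtree (`nil` has itself as left subtree). -/
def left : Data → Data
  | nil => nil
  | cons x _ => x

/-- The right subtree (`nil` has itself as right subtree). -/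
def right : Data → Data
  | nil => nil
  | cons _ y => y

/-- The unary representation of a natural number. -/
def ofNat : ℕ → Data
  | 0 => nil
  | k + 1 => cons nil (ofNat k)

/-- The representation of a list of trees. -/
def ofList : List Data → Data
  | [] => nil
  | x :: xs => cons x (ofList xs)

/-- A permutation `g` of `{0, …, n-1}` is represented by the list `g 0, …, g (n-1)`. -/
def ofPerm {n : ℕ} (g : Perm (Fin n)) : Data :=
  ofList (List.ofFn fun i => ofNat (g i : ℕ))

end Data

/-- Structured programs over trees. A program maps one tree to one tree (if it halts), and may ask
an oracle `Data → Data`. -/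
inductive Prog where
  /-- return the constant `nil` -/
  | nil : Prog
  /-- return the input -/
  | id : Prog
  /-- return the left subtree of the input -/
  | left : Prog
  /-- return the right subtree of the input -/
  | right : Prog
  /-- submit the input to the oracle and return its answer -/
  | query : Prog
  /-- run both programs on the input and join the results by `cons` -/
  | pair : Prog → Prog → Prog
  /-- run the first program, then the second one on its result -/
  | seq : Prog → Prog → Prog
  /-- `cond c p q`: run `p` if `c` returns a tree other than `nil`, and `q` if it returns `nil` -/
  | cond : Prog → Prog → Prog → Prog
  /-- `loop c p`: as long as `c` returns a tree other than `nil` on the current tree, replace the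
  current tree by the result of `p` on it -/
  | loop : Prog → Prog → Prog

/-- `Exec O p x y t`: with the oracle `O`, the program `p` halts on input `x` with output `y`, and
its running time is `t`. Every basic instruction is charged the full size of the tree it reads, an
oracle call is also charged the size of the answer, and every control step costs `1`. (So the
running time bounds the sizes of all trees that occur, oracle queries and answers included, and it
agrees up to a polynomial with the running time of oracle Turing machines.) -/
inductive Exec (O : Data → Data) : Prog → Data → Data → ℕ → Prop where
  | nil (x : Data) : Exec O Prog.nil x Data.nil x.size
  | id (x : Data) : Exec O Prog.id x x x.size
  | left (x : Data) : Exec O Prog.left x x.left x.size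
  | right (x : Data) : Exec O Prog.right x x.right x.size
  | query (x : Data) : Exec O Prog.query x (O x) (x.size + (O x).size)
  | pair {p q : Prog} {x y z : Data} {s t : ℕ} :
      Exec O p x y s → Exec O q x z t → Exec O (Prog.pair p q) x (Data.cons y z) (s + t + 1)
  | seq {p q : Prog} {x y z : Data} {s t : ℕ} :
      Exec O p x y s → Exec O q y z t → Exec O (Prog.seq p q) x z (s + t + 1)
  | condTrue {c p q : Prog} {x y z : Data} {s t : ℕ} :
      Exec O c x y s → y ≠ Data.nil → Exec O p x z t → Exec O (Prog.cond c p q) x z (s + t + 1)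
  | condFalse {c p q : Prog} {x z : Data} {s t : ℕ} :
      Exec O c x Data.nil s → Exec O q x z t → Exec O (Prog.cond c p q) x z (s + t + 1)
  | loopEnd {c p : Prog} {x : Data} {s : ℕ} :
      Exec O c x Data.nil s → Exec O (Prog.loop c p) x x (s + 1)
  | loopStep {c p : Prog} {x y x' z : Data} {s t r : ℕ} :
      Exec O c x y s → y ≠ Data.nil → Exec O p x x' t → Exec O (Prog.loop c p) x' z r →
        Exec O (Prog.loop c p) x z (s + t + r + 1)

/-- The representation of a program by a tree: the number of its head instruction, followed by
its subprograms. -/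
def Prog.code : Prog → Data
  | nil => Data.ofList [Data.ofNat 0]
  | id => Data.ofList [Data.ofNat 1]
  | left => Data.ofList [Data.ofNat 2]
  | right => Data.ofList [Data.ofNat 3]
  | query => Data.ofList [Data.ofNat 4]
  | pair p q => Data.ofList [Data.ofNat 5, p.code, q.code]
  | seq p q => Data.ofList [Data.ofNat 6, p.code, q.code]
  | cond c p q => Data.ofList [Data.ofNat 7, c.code, p.code, q.code]
  | loop c p => Data.ofList [Data.ofNat 8, c.code, p.code]

/-! ### Problems and polynomial-time reductions -/

/-- A (promise, decision or search) problem: its instances (those that satisfy the promise), their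
representations by trees, and the correct answers to each instance. -/
structure Problem where
  Inst : Type
  encode : Inst → Data
  IsAnswer : Inst → Data → Prop

/-- The oracle `O` answers every instance of `P` correctly. Nothing is known about its answers to
trees that represent no instance. -/
def Solves (O : Data → Data) (P : Problem) : Prop :=
  ∀ I : P.Inst, P.IsAnswer I (O (P.encode I))

/-- Polynomial-time (Turing) reducibility between problems `P A` and `Q A` whose instances may
refer to a black box `A`: one program and one polynomial, such that for every black box and every
oracle that solves `Q A`, the program with this oracle solves `P A` within the polynomial time
bound. -/
def PolyTimeReducible (P Q : (Data → Data) → Problem) : Prop :=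
  ∃ (M : Prog) (b : Polynomial ℕ), ∀ A O : Data → Data, Solves O (Q A) → ∀ I : (P A).Inst,
    ∃ (y : Data) (t : ℕ), Exec O M ((P A).encode I) y t ∧
      t ≤ b.eval ((P A).encode I).size ∧ (P A).IsAnswer I y

/-- Polynomial-time equivalence: reducibility in both directions. -/
def PolyTimeEquivalent (P Q : (Data → Data) → Problem) : Prop :=
  PolyTimeReducible P Q ∧ PolyTimeReducible Q P

/-! ### Hidden Shift over permutation groups

Permutations are multiplied from left to right: the product `gu` is `g.trans u`, first `g`, then
`u`. -/

/-- `u ∈ G` is a shift of the functions `f₁`, `f₂` on `G`: `f₁(g) = f₂(gu)` for all `g ∈ G`.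
Only the values of the functions on `G` matter. -/
def IsShift {n : ℕ} {α : Type*} (G : Subgroup (Perm (Fin n))) (f₁ f₂ : Perm (Fin n) → α)
    (u : Perm (Fin n)) : Prop :=
  u ∈ G ∧ ∀ g ∈ G, f₁ g = f₂ (g.trans u)

/-- The permutation group generated by a list of permutations. -/
def generatedGroup {n : ℕ} (gens : List (Perm (Fin n))) : Subgroup (Perm (Fin n)) :=
  Subgroup.closure {g | g ∈ gens}

/-- `prog`, which may call the black box `A`, computes `f g` for every `g ∈ G` within time
`bound`. -/
def ComputesOn (A : Data → Data) {n : ℕ} (prog : Prog) (bound : ℕ) (G : Subgroup (Perm (Fin n)))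
    (f : Perm (Fin n) → Data) : Prop :=
  ∀ g ∈ G, ∃ t ≤ bound, Exec A prog (Data.ofPerm g) (f g) t

/-- An instance of Hidden Shift over a permutation group: a list of generators of a group
`G ≤ Sₙ`, and two injective functions on `G`, given by programs for them (which may call the black
box `A`) and a bound on the time of one evaluation. (Programs that do nothing but call `A` give
functions that are black boxes themselves; programs that do not call `A` give functions that are
explicitly computed.) -/
structure HiddenShiftInstance (A : Data → Data) where
  degree : ℕ
  gens : List (Perm (Fin degree))
  prog₁ : Prog
  prog₂ : Prog
  bound : ℕ
  f₁ : Perm (Fin degree) → Data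
  f₂ : Perm (Fin degree) → Data
  computes₁ : ComputesOn A prog₁ bound (generatedGroup gens) f₁
  computes₂ : ComputesOn A prog₂ bound (generatedGroup gens) f₂
  injOn₁ : Set.InjOn f₁ (generatedGroup gens)
  injOn₂ : Set.InjOn f₂ (generatedGroup gens)

namespace HiddenShiftInstance

variable {A : Data → Data}

/-- The tree that a solver of the problem receives: the degree and the time bound in unary, the
generators and the two programs. -/
def encode (I : HiddenShiftInstance A) : Data :=
  Data.ofList [Data.ofNat I.degree, Data.ofList (I.gens.map Data.ofPerm),
    I.prog₁.code, I.prog₂.code, Data.ofNat I.bound]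

/-- `u` is a shift for the instance. -/
def HasShift (I : HiddenShiftInstance A) (u : Perm (Fin I.degree)) : Prop :=
  IsShift (generatedGroup I.gens) I.f₁ I.f₂ u

end HiddenShiftInstance

/-- The decision version: is there a shift? The answers "yes" and "no" are `cons nil nil` and
`nil`. -/
def hiddenShiftD (A : Data → Data) : Problem where
  Inst := HiddenShiftInstance A
  encode := HiddenShiftInstance.encode
  IsAnswer I y :=
    ((∃ u, I.HasShift u) ∧ y = Data.cons Data.nil Data.nil) ∨
      ((¬ ∃ u, I.HasShift u) ∧ y = Data.nil)

/-- The search version: find a shift if there is one. The answer is `cons nil u` for a shift `u`,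
and `nil` if there is no shift. -/
def hiddenShiftS (A : Data → Data) : Problem where
  Inst := HiddenShiftInstance A
  encode := HiddenShiftInstance.encode
  IsAnswer I y :=
    (∃ u, I.HasShift u ∧ y = Data.cons Data.nil (Data.ofPerm u)) ∨
      ((¬ ∃ u, I.HasShift u) ∧ y = Data.nil)

/-! ### The chain of point stabilizers -/

/-- `G⁽ⁱ⁾`: the pointwise stabilizer in `G` of the first `i` points. -/
def stabChain {n : ℕ} (G : Subgroup (Perm (Fin n))) (i : ℕ) : Subgroup (Perm (Fin n)) where
  carrier := {g | g ∈ G ∧ ∀ j : Fin n, (j : ℕ) < i → g j = j}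
  mul_mem' := fun {a b} ha hb =>
    ⟨G.mul_mem ha.1 hb.1, fun j hj => by rw [Perm.mul_apply, hb.2 j hj, ha.2 j hj]⟩
  one_mem' := ⟨G.one_mem, fun _ _ => rfl⟩
  inv_mem' := fun {a} ha =>
    ⟨G.inv_mem ha.1, fun j hj => by rw [Perm.inv_eq_iff_eq, ha.2 j hj]⟩

/-- `C` is a complete set of representatives of the right cosets `Hτ` of `H` in `K`. -/
def IsRightTransversal {n : ℕ} (H K : Subgroup (Perm (Fin n))) (C : Set (Perm (Fin n))) : Prop :=
  C ⊆ K ∧ ∀ g ∈ K, ∃! τ, τ ∈ C ∧ ∃ h ∈ H, g = h.trans τ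

/-- The product `σᵢ ⋯ σ₂ σ₁` (from left to right) of the first `i` terms of a sequence, where `σₖ`
is the term with index `k - 1`. -/
def descendingProd {n : ℕ} (σ : ℕ → Perm (Fin n)) : ℕ → Perm (Fin n)
  | 0 => Equiv.refl _
  | i + 1 => (σ i).trans (descendingProd σ i)

/-! ### The chain of point stabilizers -/

section StabilizerChain

variable {n : ℕ} {G : Subgroup (Perm (Fin n))}

/-! Injectivity makes a shift unique: evaluating at the identity gives `f₁(1) = f₂(u)`, which
determines `u`. Both parts rest on this.

Search reduces to decision without the stabilizer chain. Tag the values: replace `f₁(g)` by the pair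
of `f₁(g)` and the truth value of `g a = a`, and `f₂(g)` by the pair of `f₂(g)` and the truth value
of `g a = b`. The group and its generators stay the same, and injectivity is preserved. Since `u` is
injective, the tagged instance has a shift exactly when `u a = b` (`exists_hasShift_withImageTest`).
One query decides whether `u` exists, and at most `n²` tagged queries then read off its images. The
rest is bookkeeping. The reduction must write down the code of each tagged program and a unary time
bound for it. A table holds the codes of the powers of `right`, from which `makeQuery` assembles the
exact encoding of the tagged instance; `runs_nest` controls all the loops. Conversely, decision only
asks whether the answer of the search oracle is nonempty.

For the factorization, sift `u` through the chain, `u = hᵢ σᵢ ⋯ σ₁` with `hᵢ ∈ G⁽ⁱ⁾`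
(`exists_sift`). A shift `v` for the candidate `τ` must satisfy `vτ = hᵢ`, again by evaluation at
the identity, so `τ` represents the coset of `hᵢ`; conversely `hᵢ₊₁` is a shift for `τ = σᵢ₊₁`. -/

theorem mem_stabChain_zero {g : Perm (Fin n)} : g ∈ stabChain G 0 ↔ g ∈ G :=
  ⟨fun h => h.1, fun h => ⟨h, fun _ hj => absurd hj (Nat.not_lt_zero _)⟩⟩

theorem eq_refl_of_mem_stabChain {g : Perm (Fin n)} (h : g ∈ stabChain G n) :
    g = Equiv.refl _ :=
  Equiv.ext fun j => h.2 j j.isLt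

theorem trans_mem {H : Subgroup (Perm (Fin n))} {g h : Perm (Fin n)} (hg : g ∈ H) (hh : h ∈ H) :
    g.trans h ∈ H :=
  H.mul_mem hh hg

/-- Sifting: an element of `G` is the product of an element of `G⁽ⁱ⁾` and `i` coset
representatives. -/
theorem exists_sift (C : ℕ → Set (Perm (Fin n)))
    (hC : ∀ i < n, IsRightTransversal (stabChain G (i + 1)) (stabChain G i) (C i))
    {u : Perm (Fin n)} (hu : u ∈ G) :
    ∃ σ h : ℕ → Perm (Fin n), (∀ i ≤ n, h i ∈ stabChain G i ∧
        u = (h i).trans (descendingProd σ i)) ∧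
      ∀ i < n, σ i ∈ C i ∧ h i = (h (i + 1)).trans (σ i) := by
  have step : ∀ (i : ℕ) (g : Perm (Fin n)), ∃ p : Perm (Fin n) × Perm (Fin n),
      i < n → g ∈ stabChain G i → p.2 ∈ C i ∧ p.1 ∈ stabChain G (i + 1) ∧ g = p.1.trans p.2 := by
    intro i g
    by_cases hi : i < n ∧ g ∈ stabChain G i
    · obtain ⟨τ, ⟨hτ, h, hh, e⟩, -⟩ := (hC i hi.1).2 g hi.2
      exact ⟨(h, τ), fun _ _ => ⟨hτ, hh, e⟩⟩
    -- Junk value outside the range of sifting, present only so that `choose` yields total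
    -- functions.
    · exact ⟨(1, 1), fun h1 h2 => absurd ⟨h1, h2⟩ hi⟩
  choose next hnext using step
  let h : ℕ → Perm (Fin n) := fun i => Nat.rec u (fun i g => (next i g).1) i
  have hmem : ∀ i ≤ n, h i ∈ stabChain G i := by
    intro i
    induction i with
    | zero => exact fun _ => mem_stabChain_zero.2 hu
    | succ i ih => exact fun hi => (hnext i (h i) hi (ih (Nat.le_of_lt hi))).2.1
  have hfac : ∀ i < n, h i = (h (i + 1)).trans (next i (h i)).2 := fun i hi =>
    (hnext i (h i) hi (hmem i hi.le)).2.2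
  refine ⟨fun i => (next i (h i)).2, h, fun i hi => ⟨hmem i hi, ?_⟩, fun i hi =>
    ⟨(hnext i (h i) hi (hmem i hi.le)).1, hfac i hi⟩⟩
  induction i with
  | zero => rfl
  | succ i ih =>
    rw [ih (Nat.le_of_lt hi)]
    conv_lhs => rw [hfac i hi]
    rfl

theorem exists_shift_factorization {α : Type*} (C : ℕ → Set (Perm (Fin n)))
    (f₁ f₂ : Perm (Fin n) → α) (u : Perm (Fin n))
    (hC : ∀ i < n, IsRightTransversal (stabChain G (i + 1)) (stabChain G i) (C i))
    (h₂ : Set.InjOn f₂ G) (hu : IsShift G f₁ f₂ u) :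
    ∃ σ : ℕ → Perm (Fin n), u = descendingProd σ n ∧
      ∀ i < n, σ i ∈ C i ∧ ∀ τ ∈ C i,
        ((∃ v, IsShift (stabChain G (i + 1)) f₁
            (fun x => f₂ (x.trans (τ.trans (descendingProd σ i)))) v) ↔ τ = σ i) := by
  obtain ⟨σ, h, hh, hσ⟩ := exists_sift C hC hu.1
  refine ⟨σ, ?_, fun i hi => ⟨(hσ i hi).1, fun τ hτ => ⟨?_, ?_⟩⟩⟩
  · have := hh n le_rfl
    rw [eq_refl_of_mem_stabChain this.1] at this
    exact this.2
  · rintro ⟨v, hv, hshift⟩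
    obtain ⟨hmem, hfac⟩ := hh i hi.le
    have hP : descendingProd σ i ∈ G := by
      have : descendingProd σ i = (h i).symm.trans u := by rw [hfac, ← Equiv.trans_assoc]; simp
      rw [this]
      exact trans_mem (G.inv_mem hmem.1) hu.1
    -- At the identity the two shifts give `f₂(u) = f₂(v τ σᵢ ⋯ σ₁)`. Injectivity and cancellation
    -- of `σᵢ ⋯ σ₁` then leave `hᵢ = vτ`.
    have e1 := hshift 1 (Subgroup.one_mem _)
    rw [hu.2 1 G.one_mem] at e1
    have e2 := h₂ (trans_mem G.one_mem hu.1)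
      (trans_mem (trans_mem G.one_mem hv.1) (trans_mem ((hC i hi).1 hτ).1 hP)) e1
    have e3 : (h i).trans (descendingProd σ i) = (v.trans τ).trans (descendingProd σ i) := by
      rw [← hfac]; exact e2
    have e4 : h i = v.trans τ := by
      refine Equiv.ext fun x => ?_
      have := congrArg (fun e : Perm (Fin n) => e x) e3
      simpa using this
    exact ((hC i hi).2 (h i) hmem).unique ⟨hτ, v, hv, e4⟩
      ⟨(hσ i hi).1, h (i + 1), (hh (i + 1) hi).1, (hσ i hi).2⟩
  · rintro rfl
    refine ⟨h (i + 1), (hh (i + 1) hi).1, fun g hg => ?_⟩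
    rw [hu.2 g hg.1]
    exact congrArg (fun e => f₂ (g.trans e)) (hh (i + 1) hi).2

end StabilizerChain

/-! ### Sizes of trees -/

namespace Data

theorem size_pos (x : Data) : 0 < x.size := by cases x <;> simp [size]

theorem size_left_le (x : Data) : x.left.size ≤ x.size := by cases x <;> simp [size, left]; omega

theorem size_right_le (x : Data) : x.right.size ≤ x.size := by
  cases x <;> simp [size, right]; omega

theorem size_ofNat (k : ℕ) : (ofNat k).size = 2 * k + 1 := by
  induction k with
  | zero => rfl
  | succ k ih => simp only [ofNat, size, ih]; ring

theorem size_ofList_le {m : ℕ} (l : List Data) (h : ∀ x ∈ l, x.size ≤ m) :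
    (ofList l).size ≤ l.length * (m + 1) + 1 := by
  induction l with
  | nil => simp [ofList, size]
  | cons x l ih =>
    have h1 := h x (by simp)
    have h2 := ih fun y hy => h y (by simp [hy])
    simp only [ofList, size, List.length_cons, add_mul, one_mul] at *
    omega

theorem right_ofNat (k : ℕ) : (ofNat k).right = ofNat (k - 1) := by cases k <;> rfl

theorem right_iterate_ofNat (j k : ℕ) : right^[j] (ofNat k) = ofNat (k - j) := by
  induction j generalizing k with
  | zero => rfl
  | succ j ih => rw [Function.iterate_succ_apply, right_ofNat, ih, Nat.sub_sub, Nat.add_comm]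

theorem right_iterate_ofList (j : ℕ) (l : List Data) :
    right^[j] (ofList l) = ofList (l.drop j) := by
  induction j generalizing l with
  | zero => rfl
  | succ j ih => cases l with
    | nil => rw [Function.iterate_succ_apply]; simpa [ofList, right] using ih []
    | cons x l => rw [Function.iterate_succ_apply]; simpa [ofList, right] using ih l

theorem left_right_iterate_ofPerm {n : ℕ} (g : Perm (Fin n)) (a : Fin n) :
    (right^[(a : ℕ)] (ofPerm g)).left = ofNat (g a : ℕ) := by
  rw [ofPerm, right_iterate_ofList, List.drop_eq_getElem_cons (by simp)]
  simp [ofList, left]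

theorem size_ofPerm_le {n : ℕ} (g : Perm (Fin n)) : (ofPerm g).size ≤ n * (2 * n + 1) + 1 := by
  refine (size_ofList_le (m := 2 * n) _ fun x hx => ?_).trans (by simp)
  obtain ⟨i, rfl⟩ := (List.mem_ofFn' _ _).1 hx
  rw [size_ofNat]
  omega

end Data

/-! ### Running programs -/

/-- Every basic instruction pays for the tree it reads, and a query also for its answer. Hence time
bounds double as size bounds for inputs and intermediate results. -/
theorem Exec.size_le {O : Data → Data} {p : Prog} {x y : Data} {t : ℕ} (h : Exec O p x y t) :
    x.size ≤ t ∧ y.size ≤ t := by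
  induction h with
  | nil x => exact ⟨le_rfl, x.size_pos⟩
  | id x => exact ⟨le_rfl, le_rfl⟩
  | left x => exact ⟨le_rfl, x.size_left_le⟩
  | right x => exact ⟨le_rfl, x.size_right_le⟩
  | query x => omega
  | pair _ _ h1 h2 => simp only [Data.size]; omega
  | seq _ _ h1 h2 => omega
  | condTrue _ _ _ h1 h2 => omega
  | condFalse _ _ h1 h2 => omega
  | loopEnd _ h => omega
  | loopStep _ _ _ _ h1 h2 h3 => omega

/-- The program `p` maps `x` to `y` in time at most `T`. -/
def Runs (O : Data → Data) (p : Prog) (x y : Data) (T : ℕ) : Prop :=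
  ∃ t ≤ T, Exec O p x y t

namespace Runs

variable {O : Data → Data} {p q c : Prog} {x y z : Data} {S T U : ℕ}

theorem mono (h : Runs O p x y S) (hST : S ≤ T) : Runs O p x y T :=
  let ⟨t, ht, e⟩ := h
  ⟨t, ht.trans hST, e⟩

theorem size_left_le (h : Runs O p x y T) : x.size ≤ T :=
  let ⟨_, ht, e⟩ := h
  e.size_le.1.trans ht

theorem size_right_le (h : Runs O p x y T) : y.size ≤ T :=
  let ⟨_, ht, e⟩ := h
  e.size_le.2.trans ht

theorem query (h : (O x).size ≤ S) : Runs O Prog.query x (O x) (x.size + S) :=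
  ⟨_, by omega, Exec.query x⟩

theorem pair (hp : Runs O p x y S) (hq : Runs O q x z T) :
    Runs O (Prog.pair p q) x (Data.cons y z) (S + T + 1) :=
  let ⟨_, hs, e⟩ := hp
  let ⟨_, ht, f⟩ := hq
  ⟨_, by omega, e.pair f⟩

theorem seq (hp : Runs O p x y S) (hq : Runs O q y z T) :
    Runs O (Prog.seq p q) x z (S + T + 1) :=
  let ⟨_, hs, e⟩ := hp
  let ⟨_, ht, f⟩ := hq
  ⟨_, by omega, e.seq f⟩

theorem condTrue (hc : Runs O c x y S) (hy : y ≠ Data.nil) (hp : Runs O p x z T) :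
    Runs O (Prog.cond c p q) x z (S + T + 1) :=
  let ⟨_, hs, e⟩ := hc
  let ⟨_, ht, f⟩ := hp
  ⟨_, by omega, e.condTrue hy f⟩

theorem condFalse (hc : Runs O c x Data.nil S) (hq : Runs O q x z T) :
    Runs O (Prog.cond c p q) x z (S + T + 1) :=
  let ⟨_, hs, e⟩ := hc
  let ⟨_, ht, f⟩ := hq
  ⟨_, by omega, e.condFalse f⟩

/-- A loop that is controlled by the left subtree; `s k` is the state `k` rounds before the
end. -/
theorem loop_left (s : ℕ → Data) (k : ℕ) (h0 : (s 0).left = Data.nil) (hS : (s 0).size ≤ T)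
    (hs : ∀ j < k, (s (j + 1)).left ≠ Data.nil ∧ Runs O p (s (j + 1)) (s j) T) :
    Runs O (Prog.loop Prog.left p) (s k) (s 0) ((k + 1) * (2 * T + 1)) := by
  induction k with
  | zero =>
    refine ⟨(s 0).size + 1, by omega, Exec.loopEnd ?_⟩
    simpa only [h0] using Exec.left (O := O) (s 0)
  | succ k ih =>
    obtain ⟨r, hr, e⟩ := ih fun j hj => hs j (by omega)
    obtain ⟨hne, hk⟩ := hs k (by omega)
    have hsz := hk.size_left_le
    obtain ⟨t, ht, f⟩ := hk
    refine ⟨_, ?_, Exec.loopStep (Exec.left _) hne f e⟩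
    have : (k + 1 + 1) * (2 * T + 1) = (k + 1) * (2 * T + 1) + (2 * T + 1) := by ring
    omega

end Runs

/-! ### Loop-free programs run in linear time -/

namespace Prog

/-- Programs without loops and oracle calls. -/
def isSimple : Prog → Bool
  | nil => true
  | id => true
  | left => true
  | right => true
  | query => false
  | pair p q => p.isSimple && q.isSimple
  | seq p q => p.isSimple && q.isSimple
  | cond c p q => c.isSimple && p.isSimple && q.isSimple
  | loop _ _ => false

/-- The function computed by a program without loops and oracle calls. -/
def eval : Prog → Data → Data
  | nil, _ => Data.nil
  | id, x => x
  | left, x => x.left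
  | right, x => x.right
  | query, x => x
  | pair p q, x => Data.cons (p.eval x) (q.eval x)
  | seq p q, x => q.eval (p.eval x)
  | cond c p q, x => match c.eval x with
    | Data.nil => q.eval x
    | Data.cons _ _ => p.eval x
  | loop _ _, x => x

/-- The running time of a program without loops and oracle calls is at most this number times
the size of the input. -/
def cost : Prog → ℕ
  | nil => 1
  | id => 1
  | left => 1
  | right => 1
  | query => 0
  | pair p q => p.cost + q.cost + 1
  | seq p q => p.cost + q.cost * p.cost + 1
  | cond c p q => c.cost + (p.cost + q.cost) + 1
  | loop _ _ => 0

/-- In a sequence the intermediate tree has size at most `p.cost * x.size`, which explains the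
product in `cost`. Straight-line parts of the reduction can thus be verified by evaluation alone. -/
theorem runs_eval (O : Data → Data) (p : Prog) (hp : p.isSimple = true) (x : Data) :
    Runs O p x (p.eval x) (p.cost * x.size) := by
  have hx : 1 ≤ x.size := x.size_pos
  induction p generalizing x with
  | nil => exact ⟨_, by simp [cost], Exec.nil x⟩
  | id => exact ⟨_, by simp [cost], Exec.id x⟩
  | left => exact ⟨_, by simp [cost], Exec.left x⟩
  | right => exact ⟨_, by simp [cost], Exec.right x⟩
  | query => simp [isSimple] at hp
  | pair p q ihp ihq =>
    simp only [isSimple, Bool.and_eq_true] at hp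
    exact ((ihp hp.1 x hx).pair (ihq hp.2 x hx)).mono (by simp only [cost]; nlinarith)
  | seq p q ihp ihq =>
    simp only [isSimple, Bool.and_eq_true] at hp
    have h1 := ihp hp.1 x hx
    refine (h1.seq (ihq hp.2 _ (Data.size_pos _))).mono ?_
    have := Nat.mul_le_mul_left q.cost h1.size_right_le
    simp only [cost] at *
    nlinarith
  | cond c p q ihc ihp ihq =>
    simp only [isSimple, Bool.and_eq_true] at hp
    have h1 := ihc hp.1.1 x hx
    simp only [eval]
    split
    · next h =>
      rw [h] at h1
      exact (h1.condFalse (ihq hp.2 x hx)).mono (by simp only [cost]; nlinarith)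
    · next h =>
      rw [h] at h1
      exact (h1.condTrue (by simp) (ihp hp.1.2 x hx)).mono (by simp only [cost]; nlinarith)
  | loop => simp [isSimple] at hp

theorem runs_of_eval_eq {O : Data → Data} {p : Prog} {x y : Data} {S : ℕ} (hp : p.isSimple = true)
    (hxy : p.eval x = y) (hx : x.size ≤ S) : Runs O p x y (p.cost * S) :=
  hxy ▸ (p.runs_eval O hp x).mono (Nat.mul_le_mul_left _ hx)

/-- The program that returns a constant. -/
def const : Data → Prog
  | Data.nil => nil
  | Data.cons x y => pair (const x) (const y)

/-- Join the results of several programs to a list. -/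
def list : List Prog → Prog
  | [] => nil
  | p :: ps => pair p (list ps)

end Prog

/-! ### Testing the image of a point -/

namespace Prog

/-- The `k`-fold iterate of `right`. -/
def rightPow : ℕ → Prog
  | 0 => id
  | k + 1 => seq right (rightPow k)

theorem runs_rightPow (O : Data → Data) (k : ℕ) (x : Data) :
    Runs O (rightPow k) x (Data.right^[k] x) ((k + 1) * (x.size + 1)) := by
  induction k generalizing x with
  | zero => exact ⟨_, by omega, Exec.id x⟩
  | succ k ih =>
    have h : Runs O right x x.right x.size := ⟨_, le_rfl, Exec.right x⟩
    refine (h.seq (ih x.right)).mono ?_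
    have := Nat.mul_le_mul_left (k + 1) x.size_right_le
    nlinarith

/-- Is the input the unary representation of `1`? -/
def isOne : Prog := cond id (cond right nil (pair nil nil)) nil

theorem eval_isOne (k : ℕ) :
    isOne.eval (Data.ofNat k) = if k = 1 then Data.cons Data.nil Data.nil else Data.nil := by
  match k with
  | 0 => rfl
  | 1 => rfl
  | k + 2 => rw [if_neg (by omega)]; rfl

/-- Does the permutation that is the input map `a` to `b`? -/
def imageTest (a b : ℕ) : Prog :=
  seq (rightPow a) (seq left (seq (pair nil id) (seq (rightPow b) isOne)))

/-- A constant that bounds the running time of image tests. -/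
def imageTestCost : ℕ := isOne.cost * 3 + 14

/-- The test extracts `g a` in unary, adds one, removes `b` units and asks whether exactly one unit
is left. -/
theorem runs_imageTest (O : Data → Data) {n : ℕ} (g : Perm (Fin n)) (a b : Fin n) {S : ℕ}
    (hS : (Data.ofPerm g).size ≤ S) :
    Runs O (imageTest a b) (Data.ofPerm g)
      (if g a = b then Data.cons Data.nil Data.nil else Data.nil) (n * (S * imageTestCost)) := by
  have hpos : 1 ≤ S := Nat.lt_of_lt_of_le (Data.size_pos _) hS
  have h1 := runs_rightPow O a (Data.ofPerm g)
  have h2 : (Data.right^[(a : ℕ)] (Data.ofPerm g)).size ≤ S := by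
    have : ∀ (k : ℕ) (x : Data), (Data.right^[k] x).size ≤ x.size := fun k => by
      induction k with
      | zero => exact fun x => le_rfl
      | succ k ih => exact fun x => (ih x.right).trans x.size_right_le
    exact (this _ _).trans hS
  have h3 := runs_eval O left rfl (Data.right^[(a : ℕ)] (Data.ofPerm g))
  have h4 := h3.size_right_le
  simp only [eval, cost, Data.left_right_iterate_ofPerm, one_mul] at h3 h4
  have h5 := runs_eval O (pair nil id) rfl (Data.ofNat (g a : ℕ))
  have e5 : (pair nil id).eval (Data.ofNat (g a : ℕ)) = Data.ofNat ((g a : ℕ) + 1) := rfl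
  rw [e5] at h5
  have h6 := runs_rightPow O b (Data.ofNat ((g a : ℕ) + 1))
  have h7 := runs_eval O isOne rfl (Data.ofNat ((g a : ℕ) + 1 - b))
  rw [Data.right_iterate_ofNat] at h6
  -- The added unit compensates for truncated subtraction: the difference is `0` if `g a < b` and at
  -- least `2` if `g a > b`.
  have e7 : ((g a : ℕ) + 1 - b = 1) ↔ g a = b := by rw [Fin.ext_iff]; omega
  rw [eval_isOne] at h7
  simp only [e7] at h7
  refine (h1.seq (h3.seq (h5.seq (h6.seq h7)))).mono ?_
  simp only [Data.size_ofNat] at *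
  have ha : ((a : ℕ) + 1) * ((Data.ofPerm g).size + 1) ≤ n * (S * 2) :=
    Nat.mul_le_mul a.isLt (by omega)
  have hb : ((b : ℕ) + 1) * (2 * ((g a : ℕ) + 1) + 1 + 1) ≤ n * (S * 4) :=
    Nat.mul_le_mul b.isLt (by omega)
  have hc : isOne.cost * (2 * ((g a : ℕ) + 1 - b) + 1) ≤ isOne.cost * (S * 3) :=
    Nat.mul_le_mul_left _ (by omega)
  have hn : 1 * (S * (isOne.cost * 3 + 8)) ≤ n * (S * (isOne.cost * 3 + 8)) :=
    Nat.mul_le_mul_right _ (by have := a.isLt; omega)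
  have hp : (pair nil id).cost = 3 := rfl
  rw [hp]
  have e : n * (S * imageTestCost) =
      n * (S * 2) + n * (S * 4) + n * (S * (isOne.cost * 3 + 8)) := by
    rw [imageTestCost]; ring
  have e' : 1 * (S * (isOne.cost * 3 + 8)) = isOne.cost * (S * 3) + 8 * S := by ring
  omega

end Prog

/-! ### Instances tagged with an image test -/

namespace HiddenShiftInstance

variable {A : Data → Data}

/-- A run of `prog` reads its input, so `bound` also bounds the size of the permutation. The extra
`2 * bound`, multiplied by `n ≥ 1`, pays for `prog` and for the pairing. -/
theorem computes_imageTest {n : ℕ} {prog : Prog} {bound : ℕ} {G : Subgroup (Perm (Fin n))}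
    {f : Perm (Fin n) → Data} (h : ComputesOn A prog bound G f) (a b : Fin n) :
    ComputesOn A (prog.pair (Prog.imageTest a b)) (n * (bound * (Prog.imageTestCost + 2))) G
      fun g => Data.cons (f g) (if g a = b then Data.cons Data.nil Data.nil else Data.nil) := by
  intro g hg
  have h1 : Runs A prog (Data.ofPerm g) (f g) bound := h g hg
  have h0 : 1 ≤ bound := Nat.lt_of_lt_of_le (Data.size_pos _) h1.size_left_le
  have h2 := Prog.runs_imageTest A g a b h1.size_left_le
  refine (h1.pair h2).mono ?_
  have hn : 1 * (bound * 2) ≤ n * (bound * 2) :=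
    Nat.mul_le_mul_right _ (by have := a.isLt; omega)
  have e : n * (bound * (Prog.imageTestCost + 2)) =
      n * (bound * Prog.imageTestCost) + n * (bound * 2) := by ring
  omega

/-- The instance whose only possible shift is the shift `u` of the given one, and which has a
shift if and only if `u` maps `a` to `b`. -/
def withImageTest (I : HiddenShiftInstance A) (a b : Fin I.degree) : HiddenShiftInstance A where
  degree := I.degree
  gens := I.gens
  prog₁ := I.prog₁.pair (Prog.imageTest a a)
  prog₂ := I.prog₂.pair (Prog.imageTest a b)
  bound := I.degree * (I.bound * (Prog.imageTestCost + 2))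
  f₁ g := Data.cons (I.f₁ g) (if g a = a then Data.cons Data.nil Data.nil else Data.nil)
  f₂ g := Data.cons (I.f₂ g) (if g a = b then Data.cons Data.nil Data.nil else Data.nil)
  computes₁ := computes_imageTest I.computes₁ a a
  computes₂ := computes_imageTest I.computes₂ a b
  injOn₁ _ hg _ hh e := I.injOn₁ hg hh (Data.cons.inj e).1
  injOn₂ _ hg _ hh e := I.injOn₂ hg hh (Data.cons.inj e).1

theorem hasShift_unique {I : HiddenShiftInstance A} {u v : Perm (Fin I.degree)}
    (hu : I.HasShift u) (hv : I.HasShift v) : u = v := by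
  have := I.injOn₂ (trans_mem (Subgroup.one_mem _) hu.1) (trans_mem (Subgroup.one_mem _) hv.1)
    ((hu.2 1 (Subgroup.one_mem _)).symm.trans (hv.2 1 (Subgroup.one_mem _)))
  exact this

theorem hasShift_withImageTest {I : HiddenShiftInstance A} (a b : Fin I.degree)
    (v : Perm (Fin I.degree)) :
    (I.withImageTest a b).HasShift v ↔
      I.HasShift v ∧ ∀ g ∈ generatedGroup I.gens, g a = a ↔ v (g a) = b := by
  have hite : ∀ p q : Prop, ∀ [Decidable p] [Decidable q],
      ((if p then Data.cons Data.nil Data.nil else Data.nil) =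
        if q then Data.cons Data.nil Data.nil else Data.nil) ↔ (p ↔ q) := by
    intro p q _ _
    by_cases hp : p <;> by_cases hq : q <;> simp [hp, hq]
  constructor
  · rintro ⟨hv, h⟩
    exact ⟨⟨hv, fun g hg => (Data.cons.inj (h g hg)).1⟩, fun g hg =>
      (hite _ _).1 (Data.cons.inj (h g hg)).2⟩
  · rintro ⟨⟨hv, h⟩, h'⟩
    exact ⟨hv, fun g hg => congrArg₂ Data.cons (h g hg) ((hite _ _).2 (h' g hg))⟩

/-- A shift of the tagged instance equals `u` by uniqueness, and its tags at the identity give `u a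
= b`. Conversely, if `b = u a`, the tags agree because `u` is injective. -/
theorem exists_hasShift_withImageTest {I : HiddenShiftInstance A} {u : Perm (Fin I.degree)}
    (hu : I.HasShift u) (a b : Fin I.degree) :
    (∃ v, (I.withImageTest a b).HasShift v) ↔ u a = b := by
  constructor
  · rintro ⟨v, hv⟩
    obtain ⟨hv, h⟩ := (hasShift_withImageTest a b v).1 hv
    obtain rfl := hasShift_unique hu hv
    exact (h 1 (Subgroup.one_mem _)).1 rfl
  · rintro rfl
    exact ⟨u, (hasShift_withImageTest a (u a) u).2 ⟨hu, fun g _ => u.injective.eq_iff.symm⟩⟩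

end HiddenShiftInstance

local infixr:65 " ∷ " => Data.cons

/-! ### The reduction from the search version to the decision version -/

namespace Prog

/-- The subtree at the end of a path; `true` stands for a step to the right. -/
def sub : List Bool → Prog
  | [] => id
  | b :: l => seq (if b then right else left) (sub l)

/-- Add the constant `k` to the result of a program. -/
def addConst (p : Prog) : ℕ → Prog
  | 0 => p
  | k + 1 => pair nil (addConst p k)

theorem isSimple_addConst {p : Prog} (hp : p.isSimple = true) (k : ℕ) :
    (p.addConst k).isSimple = true := by
  induction k with
  | zero => exact hp
  | succ k ih => simpa [addConst, isSimple] using ih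

theorem eval_addConst {p : Prog} {x : Data} {m : ℕ} (hp : p.eval x = Data.ofNat m) (k : ℕ) :
    (p.addConst k).eval x = Data.ofNat (m + k) := by
  induction k with
  | zero => exact hp
  | succ k ih => exact congrArg (Data.cons Data.nil) ih

/-- Run a loop between an initialization and a finalization. -/
def nest (i p f : Prog) : Prog := seq i (seq (loop left p) f)

/-- A bound on the running time of `nest i p f` for simple programs `i` and `f`, if there are at
most `N` rounds of duration at most `T` on states of size at most `S`. -/
def nestTime {R : Type*} [CommSemiring R] (i f : Prog) (N S T : R) : R :=
  i.cost * S + ((N + 1) * (2 * (S + T) + 1) + f.cost * S + 1) + 1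

/-- States are indexed by the number of rounds left. A round may assume the size bound at both of
its ends, which lets an inner `nest` reuse the `S` of the outer one. -/
theorem runs_nest {O : Data → Data} {i p f : Prog} {y z : Data} {N S T : ℕ} (s : ℕ → Data) (k : ℕ)
    (hi : i.isSimple = true) (hf : f.isSimple = true) (hy : y.size ≤ S) (hiy : i.eval y = s k)
    (hfz : f.eval (s 0) = z) (h0 : (s 0).left = Data.nil) (hN : k ≤ N)
    (hS : ∀ j ≤ k, (s j).size ≤ S)
    (hs : ∀ j < k, (s (j + 1)).left ≠ Data.nil ∧
      ((s (j + 1)).size ≤ S → (s j).size ≤ S → Runs O p (s (j + 1)) (s j) T)) :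
    Runs O (nest i p f) y z (nestTime i f N S T) := by
  have hloop : Runs O (loop left p) (s k) (s 0) ((N + 1) * (2 * (S + T) + 1)) :=
    (Runs.loop_left (T := S + T) s k h0 ((hS 0 (Nat.zero_le _)).trans (Nat.le_add_right _ _))
      fun j hj => ⟨(hs j hj).1, ((hs j hj).2 (hS _ hj) (hS _ hj.le)).mono
        (Nat.le_add_left _ _)⟩).mono (Nat.mul_le_mul_right _ (by omega))
  exact (runs_of_eval_eq hi hiy hy).seq (hloop.seq (runs_of_eval_eq hf hfz (hS 0 (Nat.zero_le _))))

/-- Build the code of `seq` from the codes of its subprograms. -/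
def seqCode (p q : Prog) : Prog := list [const (Data.ofNat 6), p, q]

/-- Build the code of `pair` from the codes of its subprograms. -/
def pairCode (p q : Prog) : Prog := list [const (Data.ofNat 5), p, q]

/-- Build the code of an image test from the codes of two powers of `right`. -/
def imageTestCode (p q : Prog) : Prog :=
  seqCode p (seqCode (const left.code) (seqCode (const (pair nil id).code)
    (seqCode q (const isOne.code))))

/-- The table entry for the point `k`. -/
def entry (k : ℕ) : Data := (rightPow k).code ∷ Data.ofNat k

/-- The table for the points `k - 1, …, 0`. -/
def table : ℕ → Data
  | 0 => Data.nil
  | k + 1 => entry k ∷ table k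

/-- Each further `seq right` adds 26 nodes to the code, and each unit of the number adds 2. -/
theorem size_entry (k : ℕ) : (entry k).size = 28 * k + 7 := by
  have h : (rightPow k).code.size = 26 * k + 5 := by
    induction k with
    | zero => rfl
    | succ k ih =>
      simp only [rightPow, code, Data.ofList, Data.size, Data.size_ofNat, ih]
      ring
  rw [entry, Data.size, h, Data.size_ofNat]
  ring

theorem size_table_le {k n : ℕ} (hk : k ≤ n) : (table k).size ≤ n * (28 * n + 8) + 1 := by
  refine le_trans ?_ (Nat.add_le_add_right (Nat.mul_le_mul_right _ hk) 1)
  induction k with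
  | zero => simp [table, Data.size]
  | succ k ih =>
    have := ih (by omega)
    simp only [table, Data.size, size_entry]
    have e : (k + 1) * (28 * n + 8) = k * (28 * n + 8) + (28 * n + 8) := by ring
    omega

/-- Start with the entry for `0` and the empty table. -/
def tableInit : Prog := pair left (pair (pair (const id.code) nil) (pair nil id))

/-- Move the current entry to the table and build the next one. -/
def tableStep : Prog :=
  pair (sub [false, true])
    (pair (pair (seqCode (const right.code) (sub [true, false, false]))
        (pair nil (sub [true, false, true])))
      (pair (pair (sub [true, false]) (sub [true, true, false])) (sub [true, true, true])))

/-- Put the table in front of the input. -/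
def makeTable : Prog := nest tableInit tableStep (sub [true, true])

/-- Start with the bound `0`. -/
def boundInit : Prog := pair (sub [true, false]) (pair nil id)

/-- Start the addition of a multiple of the time bound of the input. -/
def boundInnerInit : Prog :=
  pair (sub [true, true, true, true, true, true, true, false])
    (pair (sub [true, false]) (pair (sub [false, true]) (sub [true, true])))

/-- Count down and add a constant to the bound. -/
def boundInnerStep : Prog :=
  pair (sub [false, true])
    (pair ((sub [true, false]).addConst (imageTestCost + 2)) (sub [true, true]))

/-- Return from the inner to the outer loop of `makeBound`. -/
def boundInnerFinal : Prog :=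
  pair (sub [true, true, false]) (pair (sub [true, false]) (sub [true, true, true]))

/-- Put the time bound of the queries in front of the table and the input. -/
def makeBound : Prog :=
  nest boundInit (nest boundInnerInit boundInnerStep boundInnerFinal) right

/-- Start with the empty list of images. -/
def searchInit : Prog := pair (sub [true, false]) (pair nil id)

/-- Start the search for the image of one point. -/
def searchInnerInit : Prog :=
  pair (sub [true, true, true, false])
    (pair (sub [true, false]) (pair (sub [false]) (sub [true, true])))

/-- Build the next query from the state of the search. -/
def makeQuery : Prog :=
  list [sub [true, true, true, true, true, false],
    sub [true, true, true, true, true, true, false],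
    pairCode (sub [true, true, true, true, true, true, true, false])
      (imageTestCode (sub [true, true, false, false, false]) (sub [true, true, false, false, false])),
    pairCode (sub [true, true, true, true, true, true, true, true, false])
      (imageTestCode (sub [true, true, false, false, false]) (sub [false, false, false])),
    sub [true, true, true, false]]

/-- Record the image that was found, and go on. -/
def searchFound : Prog :=
  pair (sub [false, true]) (pair (pair (sub [false, false, true]) (sub [true, false]))
    (sub [true, true]))

/-- Go on with the next candidate. -/
def searchNext : Prog := pair (sub [false, true]) (sub [true])

/-- Return from the inner to the outer loop of `search`. -/
def searchInnerFinal : Prog :=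
  pair (sub [true, true, false, true]) (pair (sub [true, false]) (sub [true, true, true]))

/-- Return the list of images as an answer. -/
def searchFinal : Prog := pair nil (sub [true, false])

/-- Find the images of all points under the shift. -/
def search : Prog :=
  nest searchInit
    (nest searchInnerInit (cond (seq makeQuery query) searchFound searchNext) searchInnerFinal)
    searchFinal

/-- Find a shift with an oracle that decides the existence of shifts. -/
def findShift : Prog := cond query (seq makeTable (seq makeBound search)) nil

/-- A bound on the running time of `makeTable`. -/
def makeTableTime {R : Type*} [CommSemiring R] (N S : R) : R :=
  nestTime tableInit (sub [true, true]) N S (tableStep.cost * S)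

/-- A bound on the running time of `makeBound`. -/
def makeBoundTime {R : Type*} [CommSemiring R] (N S : R) : R :=
  nestTime boundInit right N S
    (nestTime boundInnerInit boundInnerFinal N S (boundInnerStep.cost * S))

/-- A bound on the running time of `search`. -/
def searchTime {R : Type*} [CommSemiring R] (N S : R) : R :=
  nestTime searchInit searchFinal N S (nestTime searchInnerInit searchInnerFinal N S
    (makeQuery.cost * S + (makeQuery.cost * S + 3) + 1 +
      (searchFound.cost * S + searchNext.cost * S) + 1))

/-- A bound on the sizes of all states on inputs of size `N`. -/
def stateSize {R : Type*} [CommSemiring R] (N : R) : R :=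
  (2 * (imageTestCost + 2 : ℕ) + 300) * (N + 1) ^ 2

/-- A bound on the running time of `findShift` on inputs of size `N`. -/
def findShiftTime {R : Type*} [CommSemiring R] (N : R) : R :=
  (N + 3) + (makeTableTime N (stateSize N) +
    (makeBoundTime N (stateSize N) + searchTime N (stateSize N) + 1) + 1 + N) + 1

/-- The time bounds are defined over any commutative semiring, so one formula serves both as a
polynomial and as its value. -/
theorem eval_findShiftTime (N : ℕ) :
    (findShiftTime (Polynomial.X : Polynomial ℕ)).eval N = findShiftTime N := by
  simp [findShiftTime, makeTableTime, makeBoundTime, searchTime, stateSize, nestTime]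

end Prog

/-! ### Correctness and running time of the phases of the search -/

namespace HiddenShiftInstance

open Prog

variable {A O : Data → Data}

theorem size_encode (I : HiddenShiftInstance A) :
    2 * I.degree + 1 ≤ I.encode.size ∧ 2 * I.bound + 1 ≤ I.encode.size := by
  simp only [encode, Data.ofList, Data.size, Data.size_ofNat]
  omega

/-- The time bound of the queries. -/
def queryBound (I : HiddenShiftInstance A) : ℕ := I.degree * (I.bound * (imageTestCost + 2))

/-- The left side leaves room for the parts of any state: three tables, an entry, a list of images,
a counter, a unary number `m` and the input. -/
theorem size_le_stateSize (I : HiddenShiftInstance A) {m : ℕ} (hm : m ≤ I.queryBound) :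
    3 * (I.degree * (28 * I.degree + 8) + 1) + 28 * I.degree + (I.degree * (2 * I.degree + 1)) +
      2 * I.degree + 2 * m + 2 * I.encode.size + 30 ≤ stateSize I.encode.size := by
  obtain ⟨h1, h2⟩ := I.size_encode
  rw [queryBound] at hm
  simp only [stateSize, Nat.cast_id]
  generalize I.encode.size = N at *
  generalize I.degree = n at *
  generalize I.bound = b at *
  generalize imageTestCost = c at *
  generalize c + 2 = K at *
  have e1 : n * n ≤ (N + 1) ^ 2 := by nlinarith
  have e2 : N + 1 ≤ (N + 1) ^ 2 := by nlinarith
  have e3 : n * (b * K) ≤ K * (N + 1) ^ 2 := by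
    have : n * b ≤ (N + 1) ^ 2 := by nlinarith
    calc n * (b * K) = K * (n * b) := by ring
      _ ≤ _ := Nat.mul_le_mul_left _ this
  have e4 : 3 * (n * (28 * n + 8) + 1) + n * (2 * n + 1) = 86 * (n * n) + 25 * n + 3 := by ring
  have e5 : (2 * K + 300) * (N + 1) ^ 2 = 2 * (K * (N + 1) ^ 2) + 300 * (N + 1) ^ 2 := by ring
  omega

theorem runs_makeTable (I : HiddenShiftInstance A) :
    Runs O makeTable I.encode (table I.degree ∷ I.encode)
      (makeTableTime I.encode.size (stateSize I.encode.size)) := by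
  have hsz := I.size_le_stateSize (Nat.zero_le _)
  obtain ⟨hn, -⟩ := I.size_encode
  refine runs_nest (fun j => Data.ofNat j ∷ entry (I.degree - j) ∷ table (I.degree - j) ∷ I.encode)
    I.degree rfl rfl (by omega) ?_ ?_ rfl (by omega) (fun j hj => ?_)
    fun j hj => ⟨by simp [Data.ofNat, Data.left], fun h _ => ?_⟩
  · rw [Nat.sub_self]; rfl
  · rfl
  · have := size_table_le (Nat.sub_le I.degree j)
    simp only [Data.size, Data.size_ofNat, size_entry]
    omega
  · refine runs_of_eval_eq rfl ?_ h
    obtain ⟨i, hi⟩ := Nat.exists_eq_add_of_lt hj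
    have e1 : I.degree - (j + 1) = i := by omega
    have e2 : I.degree - j = i + 1 := by omega
    simp only [e1, e2]
    rfl

theorem runs_makeBound (I : HiddenShiftInstance A) :
    Runs O makeBound (table I.degree ∷ I.encode)
      (Data.ofNat I.queryBound ∷ table I.degree ∷ I.encode)
      (makeBoundTime I.encode.size (stateSize I.encode.size)) := by
  obtain ⟨hn, hb⟩ := I.size_encode
  have htab := size_table_le (le_refl I.degree)
  have hsz := I.size_le_stateSize le_rfl
  -- The product is computed by repeated addition: each outer round adds `I.bound * (imageTestCost +
  -- 2)`, and each inner round adds the constant `imageTestCost + 2`.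
  refine runs_nest (fun j => Data.ofNat j ∷
      Data.ofNat ((I.degree - j) * (I.bound * (imageTestCost + 2))) ∷ table I.degree ∷ I.encode)
    I.degree rfl rfl (by simp only [Data.size]; omega) ?_ rfl rfl (by omega) (fun j hj => ?_)
    fun j hj => ⟨by simp [Data.ofNat, Data.left], fun h h' => ?_⟩
  · simp only [Nat.sub_self, Nat.zero_mul]; rfl
  · have : (I.degree - j) * (I.bound * (imageTestCost + 2)) ≤ I.queryBound :=
      Nat.mul_le_mul_right _ (Nat.sub_le _ _)
    simp only [Data.size, Data.size_ofNat]
    omega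
  · obtain ⟨i, hi⟩ := Nat.exists_eq_add_of_lt hj
    have e1 : I.degree - (j + 1) = i := by omega
    have e2 : I.degree - j = i + 1 := by omega
    have e3 : (i + 1) * (I.bound * (imageTestCost + 2)) =
      i * (I.bound * (imageTestCost + 2)) + I.bound * (imageTestCost + 2) := by ring
    have e4 : (i + 1) * (I.bound * (imageTestCost + 2)) ≤ I.queryBound :=
      Nat.mul_le_mul_right _ (by omega)
    simp only [e1, e2] at h ⊢
    refine runs_nest (fun l => Data.ofNat l ∷
        Data.ofNat (i * (I.bound * (imageTestCost + 2)) + (I.bound - l) * (imageTestCost + 2)) ∷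
        Data.ofNat j ∷ table I.degree ∷ I.encode)
      I.bound rfl rfl h ?_ ?_ rfl (by omega) (fun l hl => ?_)
      fun l hl => ⟨by simp [Data.ofNat, Data.left], fun g _ => ?_⟩
    · simp only [Nat.sub_self, Nat.zero_mul]; rfl
    · rw [e3]; rfl
    · have : (I.bound - l) * (imageTestCost + 2) ≤ I.bound * (imageTestCost + 2) :=
        Nat.mul_le_mul_right _ (Nat.sub_le _ _)
      simp only [Data.size, Data.size_ofNat]
      omega
    · have hs : boundInnerStep.isSimple = true := by
        have : ((sub [true, false]).addConst (imageTestCost + 2)).isSimple = true :=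
          isSimple_addConst rfl _
        simp only [boundInnerStep, isSimple, this]
        rfl
      refine runs_of_eval_eq hs ?_ g
      have e5 : I.bound - l = I.bound - (l + 1) + 1 := by omega
      rw [e5, Nat.add_mul, Nat.one_mul, ← Nat.add_assoc]
      have := eval_addConst (p := sub [true, false]) (x := Data.ofNat (l + 1) ∷
        Data.ofNat (i * (I.bound * (imageTestCost + 2)) +
          (I.bound - (l + 1)) * (imageTestCost + 2)) ∷ Data.ofNat j ∷ table I.degree ∷ I.encode)
        rfl (imageTestCost + 2)
      simp only [boundInnerStep, eval, this]
      rfl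

/-- The assembled tree is literally the encoding of a genuine instance, so the oracle's promise
applies to it. The entries of `a` and `b` supply the codes of the two powers of `right`. -/
theorem eval_makeQuery (I : HiddenShiftInstance A) (a b : Fin I.degree) (out t₁ t₂ t : Data) :
    makeQuery.eval ((entry b ∷ t₁) ∷ out ∷ (entry a ∷ t₂) ∷
      (Data.ofNat I.queryBound ∷ t ∷ I.encode)) = (I.withImageTest a b).encode := rfl

/-- The list of the images of all points but the first `k`. -/
def images {n : ℕ} (u : Perm (Fin n)) (k : ℕ) : Data :=
  Data.ofList ((List.ofFn fun i => Data.ofNat (u i : ℕ)).drop k)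

theorem images_self {n : ℕ} (u : Perm (Fin n)) : images u n = Data.nil := by
  rw [images, List.drop_of_length_le (by simp)]; rfl

theorem images_eq_cons {n : ℕ} (u : Perm (Fin n)) (a : Fin n) :
    images u a = Data.ofNat (u a : ℕ) ∷ images u (a + 1) := by
  rw [images, List.drop_eq_getElem_cons (by simp)]
  simp [Data.ofList, images]

theorem size_images_le {n : ℕ} (u : Perm (Fin n)) (k : ℕ) :
    (images u k).size ≤ n * (2 * n + 1) + 1 := by
  refine (Data.size_ofList_le (m := 2 * n) _ fun x hx => ?_).trans
    (Nat.add_le_add_right (Nat.mul_le_mul_right _ (by simp)) 1)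
  obtain ⟨i, rfl⟩ := (List.mem_ofFn' _ _).1 (List.mem_of_mem_drop hx)
  rw [Data.size_ofNat]
  omega

theorem runs_search (hO : Solves O (hiddenShiftD A)) (I : HiddenShiftInstance A)
    {u : Perm (Fin I.degree)} (hu : I.HasShift u) :
    Runs O search (Data.ofNat I.queryBound ∷ table I.degree ∷ I.encode)
      (Data.nil ∷ Data.ofPerm u) (searchTime I.encode.size (stateSize I.encode.size)) := by
  obtain ⟨hn, -⟩ := I.size_encode
  have htab : ∀ {k}, k ≤ I.degree → _ := fun {k} => size_table_le (k := k) (n := I.degree)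
  have htab' := htab le_rfl
  have hsz := I.size_le_stateSize le_rfl
  have himg := size_images_le u
  refine runs_nest (fun k => table k ∷ images u k ∷ Data.ofNat I.queryBound ∷ table I.degree ∷
      I.encode) I.degree rfl rfl (by simp only [Data.size, Data.size_ofNat]; omega) ?_ rfl rfl
    (by omega) (fun k hk => ?_) fun k hk => ⟨by simp [table, Data.left], fun h h' => ?_⟩
  · simp only [images_self]; rfl
  · have := htab hk
    have := himg k
    simp only [Data.size, Data.size_ofNat]
    omega
  lift k to Fin I.degree using hk with a
  -- With `j` candidates left, all `b ≥ j` have been tried; hence the image of `a` is already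
  -- recorded exactly when `j ≤ u a`.
  refine runs_nest (fun j => table j ∷ (if j ≤ (u a : ℕ) then images u a else images u (a + 1)) ∷
      table (a + 1) ∷ Data.ofNat I.queryBound ∷ table I.degree ∷ I.encode)
    I.degree rfl rfl h ?_ ?_ rfl (by omega) (fun j hj => ?_)
    fun j hj => ⟨by simp [table, Data.left], fun g _ => ?_⟩
  · simp only [if_neg (Nat.not_le.2 (u a).isLt)]; rfl
  · simp only [if_pos (Nat.zero_le _)]; rfl
  · have h1 := htab hj
    have h2 : (table (a + 1)).size ≤ _ := htab a.isLt
    have : (if j ≤ (u a : ℕ) then images u a else images u (a + 1)).size ≤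
      I.degree * (2 * I.degree + 1) + 1 := by split <;> exact himg _
    simp only [Data.size, Data.size_ofNat]
    omega
  lift j to Fin I.degree using hj with b
  have hq := runs_of_eval_eq (O := O) (p := makeQuery) rfl (I.eval_makeQuery a b _ _ _ _) g
  have hqs := hq.size_right_le
  have hans := hO (I.withImageTest a b)
  simp only [hiddenShiftD, exists_hasShift_withImageTest hu] at hans
  rcases hans with ⟨hab, hans⟩ | ⟨hab, hans⟩
  · have hO' : Runs O query _ _ _ :=
      Runs.query (O := O) (x := (I.withImageTest a b).encode) (S := 3) (by rw [hans]; rfl)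
    rw [hans] at hO'
    refine ((hq.seq (hO'.mono (Nat.add_le_add_right hqs 3))).condTrue (by simp)
      ((runs_of_eval_eq (p := searchFound) rfl ?_ g).mono (Nat.le_add_right _ _)))
    subst hab
    simp only [le_refl, if_true, if_neg (Nat.not_le.2 (Nat.lt_succ_self _)), images_eq_cons]
    rfl
  · have hO' : Runs O query _ _ _ :=
      Runs.query (O := O) (x := (I.withImageTest a b).encode) (S := 3) (by rw [hans]; decide)
    rw [hans] at hO'
    refine ((hq.seq (hO'.mono (Nat.add_le_add_right hqs 3))).condFalse
      ((runs_of_eval_eq (p := searchNext) rfl ?_ g).mono (Nat.le_add_left _ _)))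
    -- The candidate `b` failed, so `u a ≠ b` and the recorded list does not change.
    have e : (b : ℕ) + 1 ≤ (u a : ℕ) ↔ (b : ℕ) ≤ (u a : ℕ) := by
      have : (u a : ℕ) ≠ b := fun h => hab (Fin.ext h)
      omega
    simp only [e]
    rfl

end HiddenShiftInstance

section Reductions

open Prog HiddenShiftInstance

/-- The first query, on the given instance itself, ensures that the search phase starts only when a
shift exists. -/
theorem hiddenShiftS_reducible_hiddenShiftD : PolyTimeReducible hiddenShiftS hiddenShiftD := by
  refine ⟨findShift, findShiftTime Polynomial.X, fun A O hO I => ?_⟩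
  rw [eval_findShiftTime]
  change ∃ y t, Exec O findShift I.encode y t ∧ t ≤ findShiftTime I.encode.size ∧
    (hiddenShiftS A).IsAnswer I y
  suffices h : ∃ y, Runs O findShift I.encode y (findShiftTime I.encode.size) ∧
      (hiddenShiftS A).IsAnswer I y by
    obtain ⟨y, ⟨t, ht, e⟩, hy⟩ := h
    exact ⟨y, t, e, ht, hy⟩
  rcases hO I with ⟨⟨u, hu⟩, hans⟩ | ⟨hno, hans⟩
  · refine ⟨_, ?_, Or.inl ⟨u, hu, rfl⟩⟩
    have hq := Runs.query (O := O) (x := I.encode) (S := 3) (le_of_eq (congrArg Data.size hans))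
    exact (hq.condTrue (fun h => by cases h.symm.trans hans) (I.runs_makeTable.seq
      (I.runs_makeBound.seq (runs_search hO I hu)))).mono (by rw [findShiftTime]; omega)
  · refine ⟨_, ?_, Or.inr ⟨hno, rfl⟩⟩
    have hq := Runs.query (O := O) (x := I.encode) (S := 3)
      ((congrArg Data.size hans).trans_le (by decide))
    rw [show O I.encode = Data.nil from hans] at hq
    exact (hq.condFalse ⟨_, le_rfl, Exec.nil _⟩).mono (by rw [findShiftTime]; omega)

/-! ### The reduction from the decision version to the search version -/

/-- Reading the answer is polynomial because a permutation has size quadratic in the degree, which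
the input contains in unary. -/
theorem hiddenShiftD_reducible_hiddenShiftS : PolyTimeReducible hiddenShiftD hiddenShiftS := by
  refine ⟨cond query (pair nil nil) nil,
    (Polynomial.X + (Polynomial.X * (2 * Polynomial.X + 1) + 3)) + 3 * Polynomial.X + 1,
    fun A O hO I => ?_⟩
  have heval : ∀ N : ℕ, ((Polynomial.X + (Polynomial.X * (2 * Polynomial.X + 1) + 3)) +
      3 * Polynomial.X + 1 : Polynomial ℕ).eval N =
      (N + (N * (2 * N + 1) + 3)) + 3 * N + 1 := by intro N; simp
  rw [heval]
  suffices h : ∃ y, Runs O (cond query (pair nil nil) nil) I.encode y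
      ((I.encode.size + (I.encode.size * (2 * I.encode.size + 1) + 3)) + 3 * I.encode.size + 1) ∧
      (hiddenShiftD A).IsAnswer I y by
    obtain ⟨y, ⟨t, ht, e⟩, hy⟩ := h
    exact ⟨y, t, e, ht, hy⟩
  rcases hO I with ⟨u, hu, hans⟩ | ⟨hno, hans⟩
  · refine ⟨_, ?_, Or.inl ⟨⟨u, hu⟩, rfl⟩⟩
    have hq := Runs.query (O := O) (x := I.encode)
      (S := I.encode.size * (2 * I.encode.size + 1) + 3) <| by
        refine (congrArg Data.size hans).trans_le ?_
        have h1 := Data.size_ofPerm_le u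
        have hd : I.degree ≤ I.encode.size := by have := I.size_encode; omega
        have h2 : I.degree * (2 * I.degree + 1) ≤ I.encode.size * (2 * I.encode.size + 1) :=
          Nat.mul_le_mul hd (by omega)
        simp only [Data.size]
        omega
    exact hq.condTrue (fun h => by cases h.symm.trans hans)
      (runs_of_eval_eq (p := pair nil nil) rfl rfl le_rfl)
  · refine ⟨_, ?_, Or.inr ⟨hno, rfl⟩⟩
    have hq := Runs.query (O := O) (x := I.encode)
      (S := I.encode.size * (2 * I.encode.size + 1) + 3)
      ((congrArg Data.size hans).trans_le (by simp only [Data.size]; omega))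
    rw [show O I.encode = Data.nil from hans] at hq
    exact (hq.condFalse ⟨_, le_rfl, Exec.nil _⟩).mono (by omega)

end Reductions

/-- Over permutation groups, the decision and search versions of Hidden Shift are polynomial-time
equivalent. Moreover, let `C i` be right coset representatives of `G⁽ⁱ⁺¹⁾` in `G⁽ⁱ⁾`, and let `u` be
the shift of `f₁`, `f₂`, injective on `G`. Then `u = σₙ ⋯ σ₁`, where the factor `σᵢ₊₁` is the only
`τ ∈ C i` such that there is a shift for `G⁽ⁱ⁺¹⁾` and the functions `f₁`, `x ↦ f₂(x τ σᵢ ⋯ σ₁)`. -/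
theorem mainTheorem6 :
    PolyTimeEquivalent hiddenShiftD hiddenShiftS ∧
    ∀ {n : ℕ} {α : Type*} (G : Subgroup (Equiv.Perm (Fin n))) (C : ℕ → Set (Equiv.Perm (Fin n)))
      (f₁ f₂ : Equiv.Perm (Fin n) → α) (u : Equiv.Perm (Fin n)),
      (∀ i < n, IsRightTransversal (stabChain G (i + 1)) (stabChain G i) (C i)) →
      Set.InjOn f₁ G → Set.InjOn f₂ G → IsShift G f₁ f₂ u →
      ∃ σ : ℕ → Equiv.Perm (Fin n),
        u = descendingProd σ n ∧
        ∀ i < n, σ i ∈ C i ∧ ∀ τ ∈ C i,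
          ((∃ v, IsShift (stabChain G (i + 1)) f₁
              (fun x => f₂ (x.trans (τ.trans (descendingProd σ i)))) v) ↔ τ = σ i) := by
  refine ⟨⟨hiddenShiftD_reducible_hiddenShiftS, hiddenShiftS_reducible_hiddenShiftD⟩, ?_⟩
  intro n α G C f₁ f₂ u hC _ h₂ hu
  exact exists_shift_factorization C f₁ f₂ u hC h₂ hu
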